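/- A convex body in $\mathbb R^2$ is a compact convex set with nonempty interior. For a convex body $K\subset\mathbb R^2$ let \[ s(K)=\inf\{\rho>0 : K-c\subset\rho(c-K)\text{ for some }c\in\mathbb R^2\} \] be its Minkowski asymmetry, and call $K$ Minkowski-centered if $K\subset s(K)(-K)$. For a Minkowski-centered convex body $K$ let $\alpha(K)>0$ be the factor for which $K\cap(-K)$ is optimally contained in $\alpha(K)\,\mathrm{conv}(K\cup(-K))$; here $A$ is optimally contained in $C$ if $A\subset C$ and there are no $\rho\in[0,1)$ and $t\in\mathbb R^2$ with $A\subset t+\rho C$. For every Minkowski-centered convex body $K\subset\mathbb R^2$, \[ \frac{2}{s(K)+1}\le\alpha(K)\le\min\left\{1,\frac{s(K)}{s(K)^2-1}\right\}. \] Moreover, for every pair $(\alpha,s)$ of real numbers with $1\le s\le 2$ and $\frac{2}{s+1}\le\alpha\le\min\left\{1,\frac{s}{s^2-1}\right\}$ there exists a Minkowski-centered convex body $K\subset\mathbb R^2$ with $s(K)=s$ and $\alpha(K)=\alpha$. Here $\frac{s}{s^2-1}$ is read as $+\infty$ for $s=1$. -/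

import Mathlib

open scoped Pointwise

/-- Convex bodies of `ℝⁿ`: full-dimensional compact convex sets. -/
structure IsConvexBody {n : ℕ} (K : Set (EuclideanSpace ℝ (Fin n))) : Prop where
  convex : Convex ℝ K
  isCompact : IsCompact K
  fullDim : (interior K).Nonempty

/-- The Minkowski asymmetry `s(K) = inf {ρ > 0 : K - c ⊆ ρ (c - K), c ∈ ℝⁿ}`. -/
noncomputable def minkowskiAsymmetry {n : ℕ} (K : Set (EuclideanSpace ℝ (Fin n))) : ℝ :=
  sInf {ρ : ℝ | 0 < ρ ∧ ∃ c : EuclideanSpace ℝ (Fin n), K - {c} ⊆ ρ • ({c} - K)}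

/-- `c` is a Minkowski center of `K`: `K - c ⊆ s(K) (c - K)`. -/
def IsMinkowskiCenter {n : ℕ} (K : Set (EuclideanSpace ℝ (Fin n)))
    (c : EuclideanSpace ℝ (Fin n)) : Prop :=
  K - {c} ⊆ minkowskiAsymmetry K • ({c} - K)

/-- `K` is Minkowski centered: `0` is a Minkowski center of `K`. -/
def IsMinkowskiCentered {n : ℕ} (K : Set (EuclideanSpace ℝ (Fin n))) : Prop :=
  IsMinkowskiCenter K 0

/-- `K` is optimally contained in `C`: `K ⊆ C`, and no translate of `ρ C` with `0 ≤ ρ < 1`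
contains `K`. -/
def IsOptimallyContained {n : ℕ} (K C : Set (EuclideanSpace ℝ (Fin n))) : Prop :=
  K ⊆ C ∧ ∀ ρ : ℝ, 0 ≤ ρ → ρ < 1 → ¬ ∃ t : EuclideanSpace ℝ (Fin n), K ⊆ ρ • C + {t}

/-- `α(K)`: the number `a > 0` such that `K ∩ (-K)` is optimally contained in
`a conv(K ∪ (-K))`. There is at most one such number, see `alpha_eq`; the infimum merely picks it
out. If there were none, the value would be `0`. -/
noncomputable def alpha {n : ℕ} (K : Set (EuclideanSpace ℝ (Fin n))) : ℝ :=
  sInf {a : ℝ | 0 < a ∧ IsOptimallyContained (K ∩ -K) (a • convexHull ℝ (K ∪ -K))}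

/-- `α(K)` is the only positive factor with the optimal containment that defines it. -/
theorem alpha_eq {n : ℕ} {K : Set (EuclideanSpace ℝ (Fin n))} {a : ℝ} (ha : 0 < a)
    (h : IsOptimallyContained (K ∩ -K) (a • convexHull ℝ (K ∪ -K))) : alpha K = a := by
  have key : ∀ b c : ℝ, 0 < b → 0 < c →
      IsOptimallyContained (K ∩ -K) (b • convexHull ℝ (K ∪ -K)) →
      IsOptimallyContained (K ∩ -K) (c • convexHull ℝ (K ∪ -K)) → c ≤ b := by
    intro b c hb hc h1 h2
    by_contra! hlt
    refine h2.2 (b / c) (by positivity) ((div_lt_one hc).2 hlt) ⟨0, ?_⟩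
    rw [smul_smul, div_mul_cancel₀ _ hc.ne', Set.singleton_zero, add_zero]
    exact h1.1
  have : {b : ℝ | 0 < b ∧ IsOptimallyContained (K ∩ -K) (b • convexHull ℝ (K ∪ -K))} = {a} := by
    ext b
    constructor
    · rintro ⟨hb, hb'⟩
      exact le_antisymm (key a b ha hb h hb') (key b a hb ha hb' h)
    · rintro rfl
      exact ⟨ha, h⟩
  rw [alpha, this, csInf_singleton]

/-! Write `C` for the convex hull of `K ∪ -K` and `s` for the asymmetry. Both `K ∩ -K` and `C` are
symmetric, so translations are useless and `alpha K` is the maximum over `K ∩ -K` of the gauge of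
`C` (`alpha_spec`).

Lower bound: some direction `u` has equal support values in `u` and `-u`. If `p`, `q` are support
points there, `(p - q) / (s + 1)` lies in `K ∩ -K` and reaches `2 / (s + 1)` times the support value
of `C` in direction `u`.

Upper bound, `s > 1`: optimality of the center yields three functionals `a i ≤ 1` on `K`, positively
dependent, with points `p i ∈ K` where `a i = -s` (`exists_touching`). Then `K ∩ -K` lies in the
hexagon `|a i| ≤ 1`. Each relevant hexagon vertex is a nonnegative combination of some `p j` and `-p
i` with coefficient sum at most `s / (s² - 1)`, by the inequality in `mul_mul_le_add_of_weights`;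
convexity of the gauge gives the rest.

Sharpness: `extremalBody s m` contains `(±1, 1)` and `(0, -s)`, which force asymmetry `s`, while the
sides through `(±1, 1)` and `(±m, 0)` tune `α` to `m`. -/

/-! ### Carathéodory's theorem and compactness of convex hulls. -/

section Compactness

variable {E : Type*} [NormedAddCommGroup E] [NormedSpace ℝ E]

theorem IsCompact.convexHull_union_of_convex {s t : Set E} (hs : IsCompact s) (ht : IsCompact t)
    (hsc : Convex ℝ s) (htc : Convex ℝ t) (hs0 : s.Nonempty) (ht0 : t.Nonempty) :
    IsCompact (convexHull ℝ (s ∪ t)) := by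
  rw [hsc.convexHull_union htc hs0 ht0]
  have h := ((isCompact_Icc (a := (0 : ℝ)) (b := 1)).prod (hs.prod ht)).image
    (f := fun x : ℝ × E × E => (1 - x.1) • x.2.1 + x.1 • x.2.2) (by fun_prop)
  convert h using 1
  ext x
  simp only [mem_convexJoin, segment_eq_image, Set.mem_image, Set.mem_prod, Prod.exists]
  constructor
  · rintro ⟨a, ha, b, hb, θ, hθ, rfl⟩
    exact ⟨θ, a, b, ⟨hθ, ha, hb⟩, rfl⟩
  · rintro ⟨θ, a, b, ⟨hθ, ha, hb⟩, rfl⟩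
    exact ⟨a, ha, b, hb, θ, hθ, rfl⟩

theorem Finset.sum_univ_eq_sum_comp_of_forall_notMem_range {ι κ M : Type*} [Fintype ι] [Fintype κ]
    [AddCommMonoid M] (e : ι ↪ κ) (f : κ → M) (hf : ∀ j, j ∉ Set.range e → f j = 0) :
    ∑ j, f j = ∑ i, f (e i) := by
  rw [← Finset.sum_map Finset.univ e f]
  symm
  refine Finset.sum_subset (Finset.subset_univ _) fun j _ hj => hf j ?_
  simpa using hj

/-- Carathéodory, padded with zero weights to a fixed number of terms. The fixed index type makes
the hull a continuous image of a simplex times a power of `s`, and later supplies exactly three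
touching directions. -/
theorem exists_fin_sum_of_mem_convexHull [FiniteDimensional ℝ E] {s : Set E} {x : E} {d : ℕ}
    (hd : Module.finrank ℝ E + 1 ≤ d) (hx : x ∈ convexHull ℝ s) :
    ∃ (w : Fin d → ℝ) (z : Fin d → E), w ∈ stdSimplex ℝ (Fin d) ∧ (∀ i, z i ∈ s) ∧
      ∑ i, w i • z i = x := by
  obtain ⟨ι, _, z, w, hz, hind, hw, hsum, rfl⟩ := eq_pos_convex_span_of_mem_convexHull hx
  have hcard : Fintype.card ι ≤ Fintype.card (Fin d) := by
    rw [Fintype.card_fin]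
    exact hind.card_le_finrank_succ.trans
      ((Nat.succ_le_succ (Submodule.finrank_le _)).trans hd)
  obtain ⟨e⟩ := Function.Embedding.nonempty_of_card_le hcard
  obtain ⟨z0, hz0⟩ : s.Nonempty := convexHull_nonempty_iff.1 ⟨_, hx⟩
  have hw0 : ∀ j, j ∉ Set.range e → Function.extend e w 0 j = 0 := fun j hj =>
    Function.extend_apply' _ _ _ hj
  refine ⟨Function.extend e w 0, Function.extend e z fun _ => z0, ⟨fun j => ?_, ?_⟩,
    fun j => ?_, ?_⟩
  · by_cases hj : j ∈ Set.range e
    · obtain ⟨i, rfl⟩ := hj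
      rw [e.injective.extend_apply]
      exact (hw i).le
    · rw [hw0 j hj]
  · rw [Finset.sum_univ_eq_sum_comp_of_forall_notMem_range e _ hw0, ← hsum]
    simp only [e.injective.extend_apply]
  · by_cases hj : j ∈ Set.range e
    · obtain ⟨i, rfl⟩ := hj
      rw [e.injective.extend_apply]
      exact hz ⟨i, rfl⟩
    · rwa [Function.extend_apply' _ _ _ hj]
  · rw [Finset.sum_univ_eq_sum_comp_of_forall_notMem_range e _
      fun j hj => by rw [hw0 j hj, zero_smul]]
    simp only [e.injective.extend_apply]

theorem IsCompact.isCompact_convexHull_of_finiteDimensional [FiniteDimensional ℝ E] {s : Set E}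
    (hs : IsCompact s) : IsCompact (convexHull ℝ s) := by
  set d := Module.finrank ℝ E + 1
  have h := ((isCompact_stdSimplex ℝ (Fin d)).prod (isCompact_univ_pi fun _ : Fin d => hs)).image
    (f := fun x : (Fin d → ℝ) × (Fin d → E) => ∑ i, x.1 i • x.2 i) (by fun_prop)
  convert h using 1
  ext x
  constructor
  · intro hx
    obtain ⟨w, z, hw, hz, rfl⟩ := exists_fin_sum_of_mem_convexHull le_rfl hx
    exact ⟨(w, z), ⟨hw, fun i _ => hz i⟩, rfl⟩
  · rintro ⟨⟨w, z⟩, ⟨hw, hz⟩, rfl⟩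
    exact (convex_convexHull ℝ s).sum_mem (fun i _ => hw.1 i) hw.2
      fun i _ => subset_convexHull ℝ s (hz i trivial)

end Compactness

/-! ### `α` as a maximum of a gauge. -/

section Alpha

variable {n : ℕ}

theorem neg_mem_convexHull_union_neg {K : Set (EuclideanSpace ℝ (Fin n))}
    {x : EuclideanSpace ℝ (Fin n)} (hx : x ∈ convexHull ℝ (K ∪ -K)) :
    -x ∈ convexHull ℝ (K ∪ -K) := by
  have : -(convexHull ℝ (K ∪ -K)) = convexHull ℝ (K ∪ -K) := by
    rw [← convexHull_neg, Set.union_neg, neg_neg, Set.union_comm]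
  rw [← this] at hx
  exact hx

theorem mem_inter_neg_comm {K : Set (EuclideanSpace ℝ (Fin n))} {x : EuclideanSpace ℝ (Fin n)}
    (hx : x ∈ K ∩ -K) : -x ∈ K ∩ -K := ⟨hx.2, by simpa using hx.1⟩

/-- For symmetric sets, translations do not help to contain one in a dilate of the other. -/
theorem isOptimallyContained_of_symmetric {A C : Set (EuclideanSpace ℝ (Fin n))}
    (hA : ∀ x ∈ A, -x ∈ A) (hC : ∀ x ∈ C, -x ∈ C) (hconv : Convex ℝ C) (hAC : A ⊆ C)
    (h : ∀ ρ : ℝ, 0 ≤ ρ → ρ < 1 → ¬ A ⊆ ρ • C) : IsOptimallyContained A C := by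
  refine ⟨hAC, fun ρ h0 h1 ⟨t, ht⟩ => h ρ h0 h1 fun x hx => ?_⟩
  have aux : ∀ y ∈ A, y - t ∈ ρ • C := by
    intro y hy
    obtain ⟨z, hz, t', ht', hzt⟩ := ht hy
    rw [Set.mem_singleton_iff.1 ht'] at hzt
    rw [← hzt]
    simpa using hz
  have h1 := aux x hx
  have h2 := aux (-x) (hA x hx)
  obtain ⟨c, hc, hc'⟩ := h1
  obtain ⟨d, hd, hd'⟩ := h2
  -- Averaging `x - t` with the negative of `-x - t` cancels the translation.
  refine ⟨(1 / 2 : ℝ) • c + (1 / 2 : ℝ) • (-d),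
    hconv hc (hC d hd) (by norm_num) (by norm_num) (by norm_num), ?_⟩
  simp only at hc' hd' ⊢
  have : (2 : ℝ) • x = ρ • c - ρ • d := by rw [hc', hd']; module
  calc ρ • ((1 / 2 : ℝ) • c + (1 / 2 : ℝ) • (-d)) = (1 / 2 : ℝ) • (ρ • c - ρ • d) := by module
    _ = x := by rw [← this]; module

/-- The maximum of the gauge exists by compactness and is positive because `0` is interior to `K ∩
-K`. Any smaller factor fails at the maximizer, so this maximum is the optimal factor. -/
theorem alpha_spec {K : Set (EuclideanSpace ℝ (Fin (n + 1)))} (hc : Convex ℝ K) (hK : IsCompact K)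
    (h0 : K ∈ nhds 0) :
    (∃ x ∈ K ∩ -K, gauge (convexHull ℝ (K ∪ -K)) x = alpha K) ∧
      ∀ x ∈ K ∩ -K, gauge (convexHull ℝ (K ∪ -K)) x ≤ alpha K := by
  set C := convexHull ℝ (K ∪ -K) with hC
  have hKC : K ⊆ C := Set.subset_union_left.trans (subset_convexHull ℝ _)
  have hCc : Convex ℝ C := convex_convexHull ℝ _
  have hC0 : C ∈ nhds 0 := Filter.mem_of_superset h0 hKC
  have hne : K.Nonempty := ⟨0, mem_of_mem_nhds h0⟩
  have hCcpt : IsCompact C := hK.convexHull_union_of_convex hK.neg hc hc.neg hne hne.neg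
  have hA : IsCompact (K ∩ -K) := hK.inter hK.neg
  have hcont := continuous_gauge hCc hC0
  obtain ⟨y, hy, hymax⟩ := hA.exists_isMaxOn
    ⟨0, mem_of_mem_nhds h0, by simpa using mem_of_mem_nhds h0⟩ hcont.continuousOn
  have hneg0 : -K ∈ nhds (0 : EuclideanSpace ℝ (Fin (n + 1))) := by
    have := neg_mem_nhds_zero _ h0
    exact this
  have hpos : 0 < gauge C y := by
    obtain ⟨z, hz, hz0⟩ : ∃ z ∈ K ∩ -K, z ≠ 0 := by
      obtain ⟨r, hr, hball⟩ := Metric.mem_nhds_iff.1 (Filter.inter_mem h0 hneg0)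
      obtain ⟨v, hv⟩ := exists_ne (0 : EuclideanSpace ℝ (Fin (n + 1)))
      have hv' : 0 < ‖v‖ := norm_pos_iff.2 hv
      refine ⟨(r / 2 / ‖v‖) • v, hball ?_, smul_ne_zero (by positivity) hv⟩
      rw [mem_ball_zero_iff, norm_smul, Real.norm_of_nonneg (by positivity),
        div_mul_cancel₀ _ hv'.ne']
      linarith
    refine lt_of_lt_of_le ?_ (hymax hz)
    exact (gauge_pos (absorbent_nhds_zero hC0)
      (NormedSpace.isVonNBounded_of_isBounded ℝ hCcpt.isBounded)).2 hz0
  have hopt : IsOptimallyContained (K ∩ -K) (gauge C y • C) := by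
    refine isOptimallyContained_of_symmetric (fun x => mem_inter_neg_comm) ?_ (hCc.smul _) ?_ ?_
    · rintro _ ⟨x, hx, rfl⟩
      exact ⟨-x, neg_mem_convexHull_union_neg hx, by simp⟩
    · intro x hx
      rw [Set.mem_smul_set_iff_inv_smul_mem₀ hpos.ne']
      refine hCcpt.isClosed.closure_subset ((gauge_le_one_iff_mem_closure hCc hC0).1 ?_)
      rw [gauge_smul_of_nonneg (inv_nonneg.2 hpos.le),
        smul_eq_mul, inv_mul_le_iff₀ hpos, mul_one]
      exact hymax hx
    · intro ρ hρ hρ1 hsub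
      have := gauge_le_of_mem (s := C) (mul_nonneg hρ hpos.le) (by
        rw [← smul_smul]; exact hsub hy)
      nlinarith
  rw [alpha_eq hpos hopt]
  exact ⟨⟨y, hy, rfl⟩, fun x hx => hymax hx⟩

end Alpha

/-! ### Support functions. -/

section Support

variable {E : Type*} [NormedAddCommGroup E] [InnerProductSpace ℝ E]

/-- The support function of `K`. -/
noncomputable def supportFunction (K : Set E) (u : E) : ℝ :=
  sSup ((fun x => inner ℝ u x) '' K)

theorem continuous_supportFunction {K : Set E} (hK : IsCompact K) :
    Continuous (supportFunction K) :=
  hK.continuous_sSup (f := fun u x : E => inner ℝ u x) (by fun_prop)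

theorem inner_le_supportFunction {K : Set E} (hK : IsCompact K) (u : E) {x : E} (hx : x ∈ K) :
    inner ℝ u x ≤ supportFunction K u :=
  le_csSup (hK.image (by fun_prop)).bddAbove ⟨x, hx, rfl⟩

theorem exists_inner_eq_supportFunction {K : Set E} (hK : IsCompact K) (hne : K.Nonempty) (u : E) :
    ∃ x ∈ K, inner ℝ u x = supportFunction K u := by
  obtain ⟨x, hx, h⟩ := hK.exists_sSup_image_eq hne (f := fun x => inner ℝ u x) (by fun_prop)
  exact ⟨x, hx, h.symm⟩

theorem supportFunction_le {K : Set E} (hne : K.Nonempty) {u : E} {r : ℝ}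
    (h : ∀ x ∈ K, inner ℝ u x ≤ r) : supportFunction K u ≤ r :=
  csSup_le (hne.image _) (by rintro _ ⟨x, hx, rfl⟩; exact h x hx)

theorem supportFunction_smul (K : Set E) {t : ℝ} (ht : 0 ≤ t) (u : E) :
    supportFunction K (t • u) = t * supportFunction K u := by
  unfold supportFunction
  rw [← smul_eq_mul, ← Real.sSup_smul_of_nonneg ht, ← Set.image_smul, Set.image_image]
  simp only [real_inner_smul_left, smul_eq_mul]

theorem supportFunction_pos {K : Set E} (hK : IsCompact K) (h0 : K ∈ nhds 0) {u : E} (hu : u ≠ 0) :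
    0 < supportFunction K u := by
  obtain ⟨r, hr, hball⟩ := Metric.mem_nhds_iff.1 h0
  have hu' : 0 < ‖u‖ := norm_pos_iff.2 hu
  have hmem : (r / 2 / ‖u‖) • u ∈ K := by
    refine hball ?_
    rw [mem_ball_zero_iff, norm_smul, Real.norm_of_nonneg (by positivity),
      div_mul_cancel₀ _ hu'.ne']
    linarith
  refine lt_of_lt_of_le ?_ (inner_le_supportFunction hK u hmem)
  rw [real_inner_smul_right, real_inner_self_eq_norm_sq]
  positivity

theorem mem_of_forall_inner_le_supportFunction [CompleteSpace E] {K : Set E} (hc : Convex ℝ K)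
    (hK : IsCompact K) (hne : K.Nonempty) {x : E}
    (h : ∀ u, inner ℝ u x ≤ supportFunction K u) : x ∈ K := by
  by_contra hx
  obtain ⟨f, r, hf, hr⟩ := geometric_hahn_banach_closed_point hc hK.isClosed hx
  have h1 := h ((InnerProductSpace.toDual ℝ E).symm f)
  have h2 : supportFunction K ((InnerProductSpace.toDual ℝ E).symm f) ≤ r :=
    supportFunction_le hne fun y hy => by
      rw [InnerProductSpace.toDual_symm_apply]
      exact (hf y hy).le
  rw [InnerProductSpace.toDual_symm_apply] at h1
  linarith

end Support

/-- First-order perturbation: where `ψ ≥ 0`, compactness keeps `φ` away from `0`, so a small `ε`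
does no harm; elsewhere `ψ < 0` helps. -/
theorem IsCompact.exists_pos_forall_add_mul_neg {X : Type*} [TopologicalSpace X] {S : Set X}
    (hS : IsCompact S) {φ ψ : X → ℝ} (hφ : Continuous φ) (hψ : Continuous ψ)
    (hle : ∀ a ∈ S, φ a ≤ 0) (hlt : ∀ a ∈ S, φ a = 0 → ψ a < 0) :
    ∃ ε > 0, ∀ a ∈ S, φ a + ε * ψ a < 0 := by
  have hT : IsCompact (S ∩ {a | 0 ≤ ψ a}) :=
    hS.inter_right (isClosed_le continuous_const hψ)
  have hlt' : ∀ a ∈ S, 0 ≤ ψ a → φ a < 0 := fun a ha h =>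
    lt_of_le_of_ne (hle a ha) fun h0 => by linarith [hlt a ha h0]
  rcases (S ∩ {a | 0 ≤ ψ a}).eq_empty_or_nonempty with he | hne
  · refine ⟨1, one_pos, fun a ha => ?_⟩
    have : ¬ 0 ≤ ψ a := fun h => by
      have : a ∈ S ∩ {a | 0 ≤ ψ a} := ⟨ha, h⟩
      rw [he] at this
      exact this
    linarith [hle a ha]
  · obtain ⟨b, hb, hbmax⟩ := hT.exists_isMaxOn hne hφ.continuousOn
    obtain ⟨c, hc, hcmax⟩ := hT.exists_isMaxOn hne hψ.continuousOn
    have hφb := hlt' b hb.1 hb.2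
    have hψc : 0 ≤ ψ c := hc.2
    have hε : 0 < -φ b / (ψ c + 1) := div_pos (by linarith) (by linarith)
    have hεeq : -φ b / (ψ c + 1) * (ψ c + 1) = -φ b := div_mul_cancel₀ _ (by linarith)
    refine ⟨_, hε, fun a ha => ?_⟩
    by_cases h : 0 ≤ ψ a
    · have h1 : φ a ≤ φ b := hbmax ⟨ha, h⟩
      have h2 : ψ a ≤ ψ c := hcmax ⟨ha, h⟩
      nlinarith
    · have := mul_neg_of_pos_of_neg hε (not_le.1 h)
      linarith [hle a ha]

/-! ### Optimality conditions for the Minkowski center. -/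

section Asymmetry

variable {n : ℕ}

theorem isMinkowskiCentered_iff {K : Set (EuclideanSpace ℝ (Fin n))} :
    IsMinkowskiCentered K ↔ ∀ x ∈ K, ∃ k ∈ K, x = -(minkowskiAsymmetry K • k) := by
  unfold IsMinkowskiCentered IsMinkowskiCenter
  rw [Set.singleton_zero, sub_zero, zero_sub]
  constructor
  · intro h x hx
    obtain ⟨k, hk, rfl⟩ := h hx
    exact ⟨-k, hk, by simp⟩
  · intro h x hx
    obtain ⟨k, hk, rfl⟩ := h x hx
    exact ⟨-k, by simpa using hk, by simp⟩

theorem minkowskiAsymmetry_le {K : Set (EuclideanSpace ℝ (Fin n))} {ρ : ℝ} (hρ : 0 < ρ)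
    (c : EuclideanSpace ℝ (Fin n)) (h : ∀ x ∈ K, ∃ k ∈ K, x - c = ρ • (c - k)) :
    minkowskiAsymmetry K ≤ ρ := by
  refine csInf_le ⟨0, fun r hr => hr.1.le⟩ ⟨hρ, c, ?_⟩
  rintro _ ⟨x, hx, _, rfl, rfl⟩
  obtain ⟨k, hk, hxk⟩ := h x hx
  exact ⟨_, ⟨_, rfl, k, hk, rfl⟩, hxk.symm⟩

theorem minkowskiAsymmetry_nonneg (K : Set (EuclideanSpace ℝ (Fin n))) :
    0 ≤ minkowskiAsymmetry K :=
  Real.sInf_nonneg fun _ hr => hr.1.le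

theorem IsMinkowskiCentered.asymmetry_pos {K : Set (EuclideanSpace ℝ (Fin (n + 1)))}
    (hb : IsConvexBody K) (h : IsMinkowskiCentered K) : 0 < minkowskiAsymmetry K := by
  refine lt_of_le_of_ne (minkowskiAsymmetry_nonneg K) fun h0 => ?_
  have hsub : K ⊆ {0} := by
    intro x hx
    obtain ⟨k, -, rfl⟩ := isMinkowskiCentered_iff.1 h x hx
    simp [← h0]
  have := hb.fullDim.mono (interior_mono hsub)
  simp at this

/-- An interior point `x` equals `-(s • k)` with `k ∈ K`, so `0` lies on the open segment from an
interior point to a point of `K`. -/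
theorem IsMinkowskiCentered.mem_nhds_zero {K : Set (EuclideanSpace ℝ (Fin (n + 1)))}
    (hb : IsConvexBody K) (h : IsMinkowskiCentered K) : K ∈ nhds 0 := by
  have hs := h.asymmetry_pos hb
  obtain ⟨x, hx⟩ := hb.fullDim
  obtain ⟨k, hk, hxk⟩ := isMinkowskiCentered_iff.1 h x (interior_subset hx)
  refine mem_interior_iff_mem_nhds.1
    (hb.convex.openSegment_interior_self_subset_interior hx hk ?_)
  set s := minkowskiAsymmetry K
  refine ⟨1 / (1 + s), s / (1 + s), by positivity, by positivity, by field_simp, ?_⟩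
  rw [hxk, smul_neg, smul_smul, ← neg_smul, ← add_smul]
  convert zero_smul ℝ k using 2
  ring

theorem IsMinkowskiCentered.supportFunction_neg_le {K : Set (EuclideanSpace ℝ (Fin (n + 1)))}
    (hb : IsConvexBody K) (h : IsMinkowskiCentered K) (u : EuclideanSpace ℝ (Fin (n + 1))) :
    supportFunction K (-u) ≤ minkowskiAsymmetry K * supportFunction K u := by
  refine supportFunction_le (hb.fullDim.mono interior_subset) fun x hx => ?_
  obtain ⟨k, hk, rfl⟩ := isMinkowskiCentered_iff.1 h x hx
  rw [inner_neg_neg, real_inner_smul_right]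
  exact mul_le_mul_of_nonneg_left (inner_le_supportFunction hb.isCompact u hk)
    (minkowskiAsymmetry_nonneg K)

theorem IsMinkowskiCentered.one_le_asymmetry {K : Set (EuclideanSpace ℝ (Fin (n + 1)))}
    (hb : IsConvexBody K) (h : IsMinkowskiCentered K) : 1 ≤ minkowskiAsymmetry K := by
  obtain ⟨u, hu⟩ := exists_ne (0 : EuclideanSpace ℝ (Fin (n + 1)))
  have h1 := h.supportFunction_neg_le hb u
  have h2 := h.supportFunction_neg_le hb (-u)
  rw [neg_neg] at h2
  have h3 := supportFunction_pos hb.isCompact (h.mem_nhds_zero hb) hu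
  have h4 := h.asymmetry_pos hb
  by_contra! hlt
  nlinarith [mul_le_mul_of_nonneg_left h1 h4.le, mul_pos h4 h3]

/-- A Minkowski-centered convex body touches `-s(K) K` in directions whose convex hull contains
the origin. -/
theorem IsMinkowskiCentered.zero_mem_convexHull_touching
    {K : Set (EuclideanSpace ℝ (Fin (n + 1)))}
    (hb : IsConvexBody K) (h : IsMinkowskiCentered K) :
    (0 : EuclideanSpace ℝ (Fin (n + 1))) ∈ convexHull ℝ {a | ‖a‖ = 1 ∧
      supportFunction K (-a) = minkowskiAsymmetry K * supportFunction K a} := by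
  have hs := h.asymmetry_pos hb
  have h0 := h.mem_nhds_zero hb
  have hcont := continuous_supportFunction hb.isCompact
  have hne : K.Nonempty := ⟨0, mem_of_mem_nhds h0⟩
  set s := minkowskiAsymmetry K with hs_def
  have hsphere : {a : EuclideanSpace ℝ (Fin (n + 1)) | ‖a‖ = 1} = Metric.sphere 0 1 := by
    ext; simp
  have hS : IsCompact {a : EuclideanSpace ℝ (Fin (n + 1)) | ‖a‖ = 1} := by
    rw [hsphere]; exact isCompact_sphere _ _
  have hSne : {a : EuclideanSpace ℝ (Fin (n + 1)) | ‖a‖ = 1}.Nonempty := by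
    rw [hsphere]; exact NormedSpace.sphere_nonempty.2 zero_le_one
  have hcont' : Continuous fun a => supportFunction K (-a) := hcont.comp continuous_neg
  have hN : IsCompact {a | ‖a‖ = 1 ∧ supportFunction K (-a) = s * supportFunction K a} :=
    hS.inter_right (isClosed_eq hcont' (by fun_prop))
  -- Otherwise a vector `v` has positive inner product with every touching direction, and moving the
  -- center slightly along `-v` makes all containment inequalities strict, which improves the
  -- asymmetry.
  by_contra hnot
  obtain ⟨f, r, hr, hf⟩ := geometric_hahn_banach_point_closed (convex_convexHull ℝ _)
    hN.isCompact_convexHull_of_finiteDimensional.isClosed hnot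
  rw [map_zero] at hr
  set v := (InnerProductSpace.toDual ℝ _).symm f with hv
  have hfv : ∀ a, f a = inner ℝ a v := fun a => by
    rw [real_inner_comm, hv, InnerProductSpace.toDual_symm_apply]
  obtain ⟨ε, hε, hneg⟩ := hS.exists_pos_forall_add_mul_neg
    (φ := fun a => supportFunction K (-a) - s * supportFunction K a)
    (ψ := fun a => -((1 + s) * inner ℝ a v)) (by fun_prop) (by fun_prop)
    (fun a _ => by linarith [h.supportFunction_neg_le hb a])
    (fun a ha ha0 => by
      have := hf a (subset_convexHull ℝ _ ⟨ha, by linarith⟩)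
      rw [hfv] at this
      have := mul_pos (show 0 < 1 + s by linarith) (hr.trans this)
      linarith)
  set c : EuclideanSpace ℝ (Fin (n + 1)) := -(ε • v) with hc
  have hac : ∀ a, inner ℝ a c = -(ε * inner ℝ a v) := fun a => by
    rw [hc, inner_neg_right, real_inner_smul_right]
  have hstrict : ∀ a : EuclideanSpace ℝ (Fin (n + 1)), ‖a‖ = 1 →
      supportFunction K (-a) + inner ℝ a c < s * (supportFunction K a - inner ℝ a c) := by
    intro a ha
    have := hneg a ha
    rw [hac]
    linarith
  have hden : ∀ a : EuclideanSpace ℝ (Fin (n + 1)), ‖a‖ = 1 →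
      0 < supportFunction K a - inner ℝ a c := by
    intro a ha
    have ha0 : a ≠ 0 := by rintro rfl; simp at ha
    have h1 := supportFunction_pos hb.isCompact h0 ha0
    have h2 := supportFunction_pos hb.isCompact h0 (neg_ne_zero.2 ha0)
    have h3 := hstrict a ha
    by_contra! hle
    have := mul_nonpos_of_nonneg_of_nonpos hs.le hle
    linarith
  obtain ⟨a₀, ha₀, hmax⟩ := hS.exists_isMaxOn hSne
    (f := fun a => (supportFunction K (-a) + inner ℝ a c) / (supportFunction K a - inner ℝ a c))
    (ContinuousOn.div (by fun_prop) (by fun_prop) fun a ha => (hden a ha).ne')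
  -- The first entry is the worst ratio for the moved center; `s / 2` only keeps `ρ` positive.
  set ρ := max ((supportFunction K (-a₀) + inner ℝ a₀ c) / (supportFunction K a₀ - inner ℝ a₀ c))
    (s / 2) with hρ
  have hρpos : 0 < ρ := lt_max_of_lt_right (by linarith)
  have hρs : ρ < s := max_lt ((div_lt_iff₀ (hden _ ha₀)).2 (hstrict _ ha₀)) (by linarith)
  have hbound : ∀ a : EuclideanSpace ℝ (Fin (n + 1)), ‖a‖ = 1 →
      supportFunction K (-a) + inner ℝ a c ≤ ρ * (supportFunction K a - inner ℝ a c) :=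
    fun a ha => (div_le_iff₀ (hden a ha)).1 ((hmax ha).trans (le_max_left _ _))
  have hbound' : ∀ a : EuclideanSpace ℝ (Fin (n + 1)),
      supportFunction K (-a) + inner ℝ a c ≤ ρ * (supportFunction K a - inner ℝ a c) := by
    intro a
    rcases eq_or_ne a 0 with rfl | ha
    · have := supportFunction_smul K le_rfl (0 : EuclideanSpace ℝ (Fin (n + 1)))
      rw [smul_zero, zero_mul] at this
      simp [this]
    · have hpos : 0 < ‖a‖ := norm_pos_iff.2 ha
      have h1 := hbound (‖a‖⁻¹ • a) (by rw [norm_smul, norm_inv, norm_norm, inv_mul_cancel₀ hpos.ne'])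
      rw [← smul_neg, supportFunction_smul K (inv_nonneg.2 hpos.le),
        supportFunction_smul K (inv_nonneg.2 hpos.le), real_inner_smul_left, ← mul_add,
        ← mul_sub, mul_left_comm] at h1
      exact le_of_mul_le_mul_left h1 (inv_pos.2 hpos)
  refine hρs.not_ge (minkowskiAsymmetry_le hρpos c fun x hx => ?_)
  refine ⟨c - ρ⁻¹ • (x - c), ?_, ?_⟩
  · refine mem_of_forall_inner_le_supportFunction hb.convex hb.isCompact hne fun a => ?_
    have h1 := inner_le_supportFunction hb.isCompact (-a) hx
    rw [inner_neg_left] at h1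
    rw [inner_sub_right, real_inner_smul_right, inner_sub_right, sub_le_iff_le_add,
      ← sub_le_iff_le_add']
    have h2 : -(ρ * (supportFunction K a - inner ℝ a c)) ≤ inner ℝ a x - inner ℝ a c := by
      linarith [hbound' a]
    have h3 := mul_le_mul_of_nonneg_left h2 (inv_nonneg.2 hρpos.le)
    rw [mul_neg, inv_mul_cancel_left₀ hρpos.ne'] at h3
    linarith
  · rw [sub_sub_cancel, smul_inv_smul₀ hρpos.ne']

end Asymmetry

/-! ### The bounds `2 / (s + 1) ≤ α ≤ 1`. -/

section LowerBound

/-- The difference of the two support values changes sign over a half turn, so the intermediate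
value theorem applies. -/
theorem exists_supportFunction_neg_eq {K : Set (EuclideanSpace ℝ (Fin 2))} (hK : IsCompact K) :
    ∃ u : EuclideanSpace ℝ (Fin 2), u ≠ 0 ∧ supportFunction K u = supportFunction K (-u) := by
  set γ : ℝ → EuclideanSpace ℝ (Fin 2) := fun θ => !₂[Real.cos θ, Real.sin θ] with hγ
  have hγc : Continuous γ := by
    rw [hγ]
    refine (PiLp.continuous_toLp 2 _).comp ?_
    refine continuous_pi fun i => ?_
    fin_cases i
    · exact Real.continuous_cos
    · exact Real.continuous_sin
  have hcont := continuous_supportFunction hK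
  have hg : Continuous fun θ => supportFunction K (γ θ) - supportFunction K (-γ θ) :=
    (hcont.comp hγc).sub (hcont.comp hγc.neg)
  have hπ : γ Real.pi = -γ 0 := by
    ext i
    fin_cases i <;> simp [hγ]
  have h := intermediate_value_uIcc (a := 0) (b := Real.pi) hg.continuousOn
  simp only [hπ, neg_neg] at h
  obtain ⟨θ, -, hθ⟩ := h (show (0 : ℝ) ∈ _ by
    rw [Set.mem_uIcc]
    rcases le_total (supportFunction K (γ 0)) (supportFunction K (-γ 0)) with h | h
    · left; constructor <;> linarith
    · right; constructor <;> linarith)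
  refine ⟨γ θ, fun h0 => ?_, by simp only at hθ; linarith⟩
  have h1 : Real.cos θ = 0 := by simpa [hγ] using congrArg (fun v => v 0) h0
  have h2 : Real.sin θ = 0 := by simpa [hγ] using congrArg (fun v => v 1) h0
  have := Real.sin_sq_add_cos_sq θ
  rw [h1, h2] at this
  norm_num at this

theorem le_gauge_of_inner_le {n : ℕ} {C : Set (EuclideanSpace ℝ (Fin n))} (hC : Absorbent ℝ C)
    {u x : EuclideanSpace ℝ (Fin n)} {H β : ℝ} (hH : 0 < H) (hu : ∀ y ∈ C, inner ℝ u y ≤ H)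
    (hx : β * H ≤ inner ℝ u x) : β ≤ gauge C x := by
  by_contra! hlt
  obtain ⟨b, hb, hbβ, y, hy, rfl⟩ := exists_lt_of_gauge_lt hC hlt
  have h1 := hu y hy
  simp only [real_inner_smul_right] at hx
  nlinarith

theorem inner_le_of_mem_convexHull {n : ℕ} {S : Set (EuclideanSpace ℝ (Fin n))}
    {u x : EuclideanSpace ℝ (Fin n)} {H : ℝ} (hu : ∀ y ∈ S, inner ℝ u y ≤ H)
    (hx : x ∈ convexHull ℝ S) : inner ℝ u x ≤ H := by
  have : Convex ℝ {y | inner ℝ u y ≤ H} :=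
    convex_halfSpace_le (innerₗ (EuclideanSpace ℝ (Fin n)) u).isLinear H
  exact convexHull_min (t := {y | inner ℝ u y ≤ H}) hu this hx

theorem convexHull_union_neg_mem_nhds_zero {n : ℕ} {K : Set (EuclideanSpace ℝ (Fin n))}
    (h0 : K ∈ nhds 0) : convexHull ℝ (K ∪ -K) ∈ nhds 0 :=
  Filter.mem_of_superset h0 (Set.subset_union_left.trans (subset_convexHull ℝ _))

theorem IsMinkowskiCentered.two_div_asymmetry_add_one_le_alpha
    {K : Set (EuclideanSpace ℝ (Fin 2))} (hb : IsConvexBody K) (h : IsMinkowskiCentered K) :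
    2 / (minkowskiAsymmetry K + 1) ≤ alpha K := by
  have hs := h.asymmetry_pos hb
  have h0 := h.mem_nhds_zero hb
  have hne : K.Nonempty := ⟨0, mem_of_mem_nhds h0⟩
  obtain ⟨u, hu, huu⟩ := exists_supportFunction_neg_eq hb.isCompact
  obtain ⟨p, hp, hup⟩ := exists_inner_eq_supportFunction hb.isCompact hne u
  obtain ⟨q, hq, huq⟩ := exists_inner_eq_supportFunction hb.isCompact hne (-u)
  have hH := supportFunction_pos hb.isCompact h0 hu
  rw [inner_neg_left] at huq
  -- With `y = -(s • k)`, the point `(x - y) / (s + 1)` is a convex combination of `x` and `k`.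
  have hmem : ∀ x ∈ K, ∀ y ∈ K, (1 / (minkowskiAsymmetry K + 1)) • (x - y) ∈ K := by
    intro x hx y hy
    obtain ⟨k, hk, rfl⟩ := isMinkowskiCentered_iff.1 h y hy
    convert hb.convex hx hk (a := 1 / (minkowskiAsymmetry K + 1))
      (b := minkowskiAsymmetry K / (minkowskiAsymmetry K + 1)) (by positivity) (by positivity)
      (by field_simp; ring) using 1
    rw [sub_neg_eq_add, smul_add, smul_smul, div_mul_eq_mul_div, one_mul]
  have hA : (1 / (minkowskiAsymmetry K + 1)) • (p - q) ∈ K ∩ -K := by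
    refine ⟨hmem p hp q hq, ?_⟩
    rw [Set.mem_neg, ← smul_neg, neg_sub]
    exact hmem q hq p hp
  refine le_trans ?_ ((alpha_spec hb.convex hb.isCompact h0).2 _ hA)
  refine le_gauge_of_inner_le (u := u)
    (absorbent_nhds_zero (convexHull_union_neg_mem_nhds_zero h0)) hH (fun y hy => ?_) ?_
  · refine inner_le_of_mem_convexHull ?_ hy
    rintro y (hy | hy)
    · exact inner_le_supportFunction hb.isCompact u hy
    · have := inner_le_supportFunction hb.isCompact (-u) hy
      rw [inner_neg_neg] at this
      linarith
  · rw [real_inner_smul_right, inner_sub_right, hup, ← neg_eq_iff_eq_neg.2 huq.symm, ← huu]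
    apply le_of_eq
    ring

theorem IsMinkowskiCentered.alpha_le_one
    {K : Set (EuclideanSpace ℝ (Fin 2))} (hb : IsConvexBody K) (h : IsMinkowskiCentered K) :
    alpha K ≤ 1 := by
  obtain ⟨⟨x, hx, hxα⟩, -⟩ := alpha_spec hb.convex hb.isCompact (h.mem_nhds_zero hb)
  rw [← hxα]
  exact gauge_le_one_of_mem (subset_convexHull ℝ _ (Or.inl hx.1))

end LowerBound

/-! ### The bound `α ≤ s / (s² - 1)`. -/

section UpperBound

/-- The claim is `s ≤ 1/β + 1/β'`, and the hypotheses bound these reciprocals below by `l / (n + s(l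
- m))` and `m / (n - s(l - m))`. -/
theorem mul_mul_le_add_of_weights {s l m n β β' : ℝ} (hs : 1 < s) (hl : 0 < l) (hm : 0 < m)
    (hn : 0 < n) (hn1 : n ≤ 1) (hsum : l + m + n = s + 1) (hβ : 0 < β) (hβ' : 0 < β')
    (h1 : l * β ≤ n + s * (l - m)) (h2 : m * β' ≤ n - s * (l - m)) :
    s * (β * β') ≤ β + β' := by
  have hP : 0 < n + s * (l - m) := (mul_pos hl hβ).trans_le h1
  have hQ : 0 < n - s * (l - m) := (mul_pos hm hβ').trans_le h2
  have h3 : l / (n + s * (l - m)) ≤ 1 / β := by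
    rw [div_le_div_iff₀ hP hβ]; linarith
  have h4 : m / (n - s * (l - m)) ≤ 1 / β' := by
    rw [div_le_div_iff₀ hQ hβ']; linarith
  have h5 : s ≤ l / (n + s * (l - m)) + m / (n - s * (l - m)) := by
    rw [div_add_div _ _ hP.ne' hQ.ne', le_div_iff₀ (mul_pos hP hQ)]
    -- After clearing denominators, the difference of the two sides is the sum of the nonnegative
    -- quantities in `h6` and `h7`.
    have h6 : 0 ≤ n * ((s + 1) * (1 - n)) :=
      mul_nonneg hn.le (mul_nonneg (by linarith) (by linarith))
    have h7 : 0 ≤ s * (s ^ 2 - 1) * (l - m) ^ 2 :=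
      mul_nonneg (mul_nonneg (by linarith) (by nlinarith)) (sq_nonneg _)
    have h8 : n * ((s + 1) * (1 - n)) = n * (l + m - s * n) := by
      linear_combination (-n) * hsum
    nlinarith
  have h6 : s ≤ 1 / β + 1 / β' := by linarith
  rw [div_add_div _ _ hβ.ne' hβ'.ne', le_div_iff₀ (mul_pos hβ hβ')] at h6
  linarith

variable {E : Type*} [NormedAddCommGroup E] [InnerProductSpace ℝ E]

/-- Expresses the hexagon vertex `a = 1`, `b = -1` through `q` and `-p`. The bound on the
coefficient sum is equivalent to `s β β' ≤ β + β'`. -/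
theorem exists_vertex {a b c p q : E} {s l m n : ℝ} (hs : 1 < s) (hl : 0 < l) (hm : 0 < m)
    (hn : 0 < n) (hn1 : n ≤ 1) (hsum : l + m + n = s + 1)
    (hrel : ∀ x : E, l * inner ℝ a x + m * inner ℝ b x + n * inner ℝ c x = 0)
    (hap : inner ℝ a p = -s) (hbq : inner ℝ b q = -s) (hbp : inner ℝ b p ≤ 1)
    (hcp : inner ℝ c p ≤ 1) (haq : inner ℝ a q ≤ 1) (hcq : inner ℝ c q ≤ 1) :
    ∃ μ ν : ℝ, 0 ≤ μ ∧ 0 ≤ ν ∧ μ + ν ≤ s / (s ^ 2 - 1) ∧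
      inner ℝ a (μ • q + ν • -p) = 1 ∧ inner ℝ b (μ • q + ν • -p) = -1 := by
  set β := s - inner ℝ a q with hβ_def
  set β' := s - inner ℝ b p with hβ'_def
  have hβ : 0 < β := by linarith
  have hβ' : 0 < β' := by linarith
  have hkey : s * (β * β') ≤ β + β' := by
    refine mul_mul_le_add_of_weights hs hl hm hn hn1 hsum hβ hβ' ?_ ?_
    · have := hrel q
      rw [hbq] at this
      nlinarith
    · have := hrel p
      rw [hap] at this
      nlinarith
  have hD : (s ^ 2 - 1) * (β + β') ≤ s * (s * (β + β') - β * β') := by nlinarith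
  have hs2 : 0 < s ^ 2 - 1 := by nlinarith
  have hDpos : 0 < s * (β + β') - β * β' := by
    have : 0 < (s ^ 2 - 1) * (β + β') := mul_pos hs2 (by linarith)
    exact pos_of_mul_pos_right (this.trans_le hD) (by linarith)
  have hDne := hDpos.ne'
  -- Cramer's rule for the two equations in `μ` and `ν`.
  refine ⟨β' / (s * (β + β') - β * β'), β / (s * (β + β') - β * β'), by positivity,
    by positivity, ?_, ?_, ?_⟩
  · rw [← add_div, div_le_div_iff₀ hDpos hs2]
    linarith
  · simp only [inner_add_right, real_inner_smul_right, inner_neg_right]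
    rw [hap, show inner ℝ a q = s - β by rw [hβ_def]; ring, ← div_self hDne]
    ring
  · simp only [inner_add_right, real_inner_smul_right, inner_neg_right]
    rw [hbq, show inner ℝ b p = s - β' by rw [hβ'_def]; ring, ← div_self hDne]
    ring

theorem inner_fin_two (x y : EuclideanSpace ℝ (Fin 2)) : inner ℝ x y = x 0 * y 0 + x 1 * y 1 := by
  simp [PiLp.inner_apply, Fin.sum_univ_two, mul_comm]

theorem eq_zero_of_inner_eq_zero {a b y z v : EuclideanSpace ℝ (Fin 2)}
    (hdet : inner ℝ a y * inner ℝ b z - inner ℝ a z * inner ℝ b y ≠ 0)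
    (ha : inner ℝ a v = 0) (hb : inner ℝ b v = 0) : v = 0 := by
  simp only [inner_fin_two] at hdet ha hb
  have hab : a 0 * b 1 - a 1 * b 0 ≠ 0 := by
    intro h
    apply hdet
    linear_combination (y 0 * z 1 - y 1 * z 0) * h
  have h0 : (a 0 * b 1 - a 1 * b 0) * v 0 = 0 := by linear_combination b 1 * ha - a 1 * hb
  have h1 : (a 0 * b 1 - a 1 * b 0) * v 1 = 0 := by linear_combination a 0 * hb - b 0 * ha
  ext i
  fin_cases i
  · exact (mul_eq_zero.1 h0).resolve_left hab
  · exact (mul_eq_zero.1 h1).resolve_left hab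

theorem gauge_smul_add_smul_le {C : Set E} (hC : Convex ℝ C) (habs : Absorbent ℝ C)
    {x y : E} {κ μ ν : ℝ} (hμ : 0 ≤ μ) (hν : 0 ≤ ν) (hx : gauge C x ≤ κ) (hy : gauge C y ≤ κ) :
    gauge C (μ • x + ν • y) ≤ (μ + ν) * κ := by
  refine (gauge_add_le hC habs _ _).trans ?_
  rw [gauge_smul_of_nonneg hμ, gauge_smul_of_nonneg hν, smul_eq_mul, smul_eq_mul, add_mul]
  exact add_le_add (mul_le_mul_of_nonneg_left hx hμ) (mul_le_mul_of_nonneg_left hy hν)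

/-- When `a` attains the largest absolute value `M` at `x`, the point `x` lies on the segment from
`M • y` to `M • z`, where `y` is the vertex `a = 1, b = -1` and `z` the vertex `a = 1, c = -1`. Both
vertices are controlled by `exists_vertex`. -/
theorem gauge_le_of_touching_of_max {a b c p q r x : EuclideanSpace ℝ (Fin 2)}
    {C : Set (EuclideanSpace ℝ (Fin 2))} {s l m n M : ℝ} (hC : Convex ℝ C) (habs : Absorbent ℝ C)
    (hs : 1 < s) (hl : 0 < l) (hm : 0 < m) (hn : 0 < n) (hsum : l + m + n = s + 1)
    (hrel : ∀ x, l * inner ℝ a x + m * inner ℝ b x + n * inner ℝ c x = 0)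
    (hap : inner ℝ a p = -s) (hbp : inner ℝ b p ≤ 1) (hcp : inner ℝ c p ≤ 1)
    (haq : inner ℝ a q ≤ 1) (hbq : inner ℝ b q = -s) (hcq : inner ℝ c q ≤ 1)
    (har : inner ℝ a r ≤ 1) (hbr : inner ℝ b r ≤ 1) (hcr : inner ℝ c r = -s)
    (hp : -p ∈ C) (hq : q ∈ C) (hr : r ∈ C)
    (hM : M ≤ 1) (hax : inner ℝ a x = M) (hbx : |inner ℝ b x| ≤ M) (hcx : |inner ℝ c x| ≤ M) :
    gauge C x ≤ s / (s ^ 2 - 1) := by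
  have hl1 : l ≤ 1 := by
    have := hrel p
    rw [hap] at this
    nlinarith
  have hm1 : m ≤ 1 := by
    have := hrel q
    rw [hbq] at this
    nlinarith
  have hn1 : n ≤ 1 := by
    have := hrel r
    rw [hcr] at this
    nlinarith
  have hκ : 0 ≤ s / (s ^ 2 - 1) := div_nonneg (by linarith) (by nlinarith)
  obtain ⟨μ, ν, hμ, hν, hμν, hay, hby⟩ :=
    exists_vertex hs hl hm hn hn1 hsum hrel hap hbq hbp hcp haq hcq
  obtain ⟨μ', ν', hμ', hν', hμν', haz, hcz⟩ :=
    exists_vertex (a := a) (b := c) (c := b) (p := p) (q := r) hs hl hn hm hm1 (by linarith)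
      (fun x => by linarith [hrel x]) hap hcr hcp hbp har hbr
  have hy : gauge C (μ • q + ν • -p) ≤ s / (s ^ 2 - 1) := by
    have := gauge_smul_add_smul_le hC habs hμ hν (gauge_le_one_of_mem hq) (gauge_le_one_of_mem hp)
    linarith
  have hz : gauge C (μ' • r + ν' • -p) ≤ s / (s ^ 2 - 1) := by
    have := gauge_smul_add_smul_le hC habs hμ' hν' (gauge_le_one_of_mem hr)
      (gauge_le_one_of_mem hp)
    linarith
  set y := μ • q + ν • -p
  set z := μ' • r + ν' • -p
  have hbz : m * inner ℝ b z = n - l := by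
    have := hrel z
    rw [haz, hcz] at this
    linarith
  have hd : 0 < m + n - l := by linarith
  have hxrel := hrel x
  rw [hax] at hxrel
  rw [abs_le] at hbx hcx
  -- Solves `b x = -(M - θ) + θ * b z`. Here `θ ≥ 0` encodes `b x ≥ -M`, and `θ ≤ M` encodes `c x ≥
  -- -M`.
  set θ := (M + inner ℝ b x) * m / (m + n - l) with hθ
  have hθ0 : 0 ≤ θ := div_nonneg (mul_nonneg (by linarith) hm.le) hd.le
  have hθM : θ ≤ M := by
    rw [hθ, div_le_iff₀ hd]
    nlinarith
  have hθmul : θ * (m + n - l) = (M + inner ℝ b x) * m := div_mul_cancel₀ _ hd.ne'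
  have hbz1 : inner ℝ b z + 1 = (m + n - l) / m := by
    rw [eq_div_iff hm.ne']
    linarith
  have hxyz : x - ((M - θ) • y + θ • z) = 0 := by
    refine eq_zero_of_inner_eq_zero (a := a) (b := b) (y := y) (z := z) ?_ ?_ ?_
    · rw [hay, haz, hby]
      have : 0 < (m + n - l) / m := by positivity
      linarith
    · simp only [inner_sub_right, inner_add_right, real_inner_smul_right, hax, hay, haz]
      ring
    · simp only [inner_sub_right, inner_add_right, real_inner_smul_right, hby]
      apply mul_left_cancel₀ hm.ne'
      linear_combination -hθmul - θ * hbz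
  rw [sub_eq_zero.1 hxyz]
  refine (gauge_smul_add_smul_le hC habs (by linarith) hθ0 hy hz).trans ?_
  rw [sub_add_cancel]
  exact mul_le_of_le_one_left hκ hM

/-- Symmetry of `C` and relabelling reduce to the case where the first functional is maximal in
absolute value and nonnegative. -/
theorem gauge_le_of_touching {a p : Fin 3 → EuclideanSpace ℝ (Fin 2)}
    {C : Set (EuclideanSpace ℝ (Fin 2))} {s : ℝ} {l : Fin 3 → ℝ} (hC : Convex ℝ C)
    (habs : Absorbent ℝ C) (hneg : ∀ x ∈ C, -x ∈ C) (hs : 1 < s) (hl : ∀ i, 0 < l i)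
    (hsum : ∑ i, l i = s + 1) (hrel : ∑ i, l i • a i = 0)
    (hapi : ∀ i, inner ℝ (a i) (p i) = -s) (hap : ∀ i j, inner ℝ (a i) (p j) ≤ 1)
    (hp : ∀ i, p i ∈ C) {x : EuclideanSpace ℝ (Fin 2)} (hx : ∀ i, |inner ℝ (a i) x| ≤ 1) :
    gauge C x ≤ s / (s ^ 2 - 1) := by
  have hrel' : ∀ x, l 0 * inner ℝ (a 0) x + l 1 * inner ℝ (a 1) x + l 2 * inner ℝ (a 2) x = 0 := by
    intro x
    have := congrArg (fun v => inner ℝ v x) hrel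
    simpa [Fin.sum_univ_three, inner_add_left, real_inner_smul_left] using this
  rw [Fin.sum_univ_three] at hsum
  have key : ∀ i j k : Fin 3, i ≠ j → i ≠ k → j ≠ k →
      |inner ℝ (a j) x| ≤ |inner ℝ (a i) x| → |inner ℝ (a k) x| ≤ |inner ℝ (a i) x| →
      gauge C x ≤ s / (s ^ 2 - 1) := by
    intro i j k hij hik hjk hj hk
    have hsum' : l i + l j + l k = s + 1 := by
      fin_cases i <;> fin_cases j <;> fin_cases k <;> simp_all <;> linarith
    have hrel'' : ∀ x, l i * inner ℝ (a i) x + l j * inner ℝ (a j) x + l k * inner ℝ (a k) x = 0 := by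
      intro x
      have := hrel' x
      clear hj hk hsum hsum' hrel hrel' hx hap hapi
      fin_cases i <;> fin_cases j <;> fin_cases k <;> simp at hij hik hjk <;> simp <;> linarith
    rcases abs_choice (inner ℝ (a i) x) with h | h
    · exact gauge_le_of_touching_of_max hC habs hs (hl i) (hl j) (hl k) hsum' hrel'' (hapi i)
        (hap j i) (hap k i) (hap i j) (hapi j) (hap k j) (hap i k) (hap j k) (hapi k)
        (hneg _ (hp i)) (hp j) (hp k) (hx i) h.symm hj hk
    · rw [← gauge_neg hneg]
      refine gauge_le_of_touching_of_max hC habs hs (hl i) (hl j) (hl k) hsum' hrel'' (hapi i)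
        (hap j i) (hap k i) (hap i j) (hapi j) (hap k j) (hap i k) (hap j k) (hapi k)
        (hneg _ (hp i)) (hp j) (hp k) (hx i) ?_ ?_ ?_
      · rw [inner_neg_right, h]
      · rwa [inner_neg_right, abs_neg]
      · rwa [inner_neg_right, abs_neg]
  obtain ⟨i, -, hi⟩ := Finset.exists_max_image Finset.univ (fun i => |inner ℝ (a i) x|)
    Finset.univ_nonempty
  have hi' : ∀ j, |inner ℝ (a j) x| ≤ |inner ℝ (a i) x| := fun j => hi j (Finset.mem_univ j)
  exact key i (i + 1) (i + 2) (by fin_cases i <;> decide) (by fin_cases i <;> decide)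
    (by fin_cases i <;> decide) (hi' _) (hi' _)

/-- Three touching directions with positive weights and the corresponding touching points. -/
theorem IsMinkowskiCentered.exists_touching
    {K : Set (EuclideanSpace ℝ (Fin 2))} (hb : IsConvexBody K) (h : IsMinkowskiCentered K)
    (hs : 1 < minkowskiAsymmetry K) :
    ∃ (a p : Fin 3 → EuclideanSpace ℝ (Fin 2)) (l : Fin 3 → ℝ), (∀ i, 0 < l i) ∧
      ∑ i, l i = minkowskiAsymmetry K + 1 ∧ ∑ i, l i • a i = 0 ∧ (∀ i, p i ∈ K) ∧
      (∀ i, inner ℝ (a i) (p i) = -minkowskiAsymmetry K) ∧ ∀ i, ∀ x ∈ K, inner ℝ (a i) x ≤ 1 := by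
  have h0 := h.mem_nhds_zero hb
  have hne : K.Nonempty := ⟨0, mem_of_mem_nhds h0⟩
  obtain ⟨w, z, hw, hz, hwz⟩ := exists_fin_sum_of_mem_convexHull (d := 3) (by simp)
    (h.zero_mem_convexHull_touching hb)
  set s := minkowskiAsymmetry K
  have hz0 : ∀ i, z i ≠ 0 := fun i hi => by simpa [hi] using (hz i).1
  have hpos : ∀ i, 0 < supportFunction K (z i) := fun i =>
    supportFunction_pos hb.isCompact h0 (hz0 i)
  -- Touching in two opposite directions would force `s² = 1`. Hence no two of the directions
  -- balance each other, and all three weights are positive.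
  have hopp : ∀ i j, z i ≠ -z j := by
    intro i j hij
    have h1 := (hz i).2
    have h2 := (hz j).2
    rw [hij, neg_neg] at h1
    have := hpos j
    have := hpos i
    rw [hij] at this
    nlinarith
  have hpair : ∀ i j (u v : ℝ), 0 ≤ u → 0 ≤ v → u • z i + v • z j = 0 → u = 0 ∧ v = 0 := by
    intro i j u v hu hv huv
    have h1 : u • z i = -(v • z j) := eq_neg_of_add_eq_zero_left huv
    have h2 : u = v := by
      have := congrArg norm h1
      rwa [norm_neg, norm_smul, norm_smul, (hz i).1, (hz j).1, Real.norm_of_nonneg hu,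
        Real.norm_of_nonneg hv, mul_one, mul_one] at this
    subst h2
    by_contra hne0
    have hu0 : u ≠ 0 := fun h => hne0 ⟨h, h⟩
    refine hopp i j (smul_right_injective _ hu0 ?_)
    simpa using h1
  have hwpos : ∀ i, 0 < w i := by
    have hwsum := hw.2
    rw [Fin.sum_univ_three] at hwz hwsum
    have hex : ∀ i, w i ≠ 0 := by
      intro i hi
      fin_cases i
      · simp only [Fin.zero_eta, Fin.isValue] at hi
        have := hpair 1 2 (w 1) (w 2) (hw.1 _) (hw.1 _) (by simpa [hi] using hwz)
        linarith
      · simp only [Fin.mk_one, Fin.isValue] at hi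
        have := hpair 0 2 (w 0) (w 2) (hw.1 _) (hw.1 _) (by simpa [hi] using hwz)
        linarith
      · simp only [Fin.reduceFinMk, Fin.isValue] at hi
        have := hpair 0 1 (w 0) (w 1) (hw.1 _) (hw.1 _) (by simpa [hi] using hwz)
        linarith
    exact fun i => lt_of_le_of_ne (hw.1 i) (hex i).symm
  choose p hp hpz using fun i => exists_inner_eq_supportFunction hb.isCompact hne (-z i)
  set T := ∑ i, w i * supportFunction K (z i) with hT
  have hTpos : 0 < T := Finset.sum_pos (fun i _ => mul_pos (hwpos i) (hpos i)) Finset.univ_nonempty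
  -- Directions are rescaled to support value `1`, the weights inversely, and then all weights
  -- jointly to total `s + 1`.
  refine ⟨fun i => (supportFunction K (z i))⁻¹ • z i, p,
    fun i => (s + 1) / T * (w i * supportFunction K (z i)), fun i => ?_, ?_, ?_, hp, ?_, ?_⟩
  · have := mul_pos (hwpos i) (hpos i)
    positivity
  · rw [← Finset.mul_sum, ← hT, div_mul_cancel₀ _ hTpos.ne']
  · have : ∀ i, ((s + 1) / T * (w i * supportFunction K (z i))) • (supportFunction K (z i))⁻¹ • z i
        = ((s + 1) / T) • w i • z i := by
      intro i
      rw [smul_smul, smul_smul]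
      congr 1
      rw [mul_assoc, mul_assoc, mul_inv_cancel₀ (hpos i).ne', mul_one]
    simp only [this]
    rw [← Finset.smul_sum, hwz, smul_zero]
  · intro i
    have h1 := hpz i
    rw [(hz i).2, inner_neg_left] at h1
    rw [real_inner_smul_left, ← neg_eq_iff_eq_neg.2 h1.symm, mul_neg, mul_left_comm,
      inv_mul_cancel₀ (hpos i).ne', mul_one]
  · intro i x hx
    rw [real_inner_smul_left, inv_mul_le_iff₀ (hpos i), mul_one]
    exact inner_le_supportFunction hb.isCompact _ hx

theorem IsMinkowskiCentered.alpha_le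
    {K : Set (EuclideanSpace ℝ (Fin 2))} (hb : IsConvexBody K) (h : IsMinkowskiCentered K)
    (hs : minkowskiAsymmetry K ≠ 1) :
    alpha K ≤ minkowskiAsymmetry K / (minkowskiAsymmetry K ^ 2 - 1) := by
  have hs1 := lt_of_le_of_ne (h.one_le_asymmetry hb) hs.symm
  have h0 := h.mem_nhds_zero hb
  obtain ⟨a, p, l, hl, hsum, hrel, hp, hapi, ha⟩ := h.exists_touching hb hs1
  obtain ⟨⟨x, hx, hxα⟩, -⟩ := alpha_spec hb.convex hb.isCompact h0
  rw [← hxα]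
  refine gauge_le_of_touching (convex_convexHull ℝ _)
    (absorbent_nhds_zero (convexHull_union_neg_mem_nhds_zero h0))
    (fun _ => neg_mem_convexHull_union_neg) hs1 hl hsum hrel hapi (fun i j => ha i _ (hp j))
    (fun i => subset_convexHull ℝ _ (Or.inl (hp i))) fun i => abs_le.2 ⟨?_, ha i x hx.1⟩
  have := ha i (-x) hx.2
  rw [inner_neg_right] at this
  linarith

end UpperBound

/-! ### Bodies realizing every admissible pair. -/

section Example

/-- A family of pentagons and hexagons, symmetric in the first coordinate, with Minkowski asymmetry
`s` and with `α` equal to `m`. -/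
def extremalBody (s m : ℝ) : Set (EuclideanSpace ℝ (Fin 2)) :=
  {x | x 1 ≤ 1 ∧ (s ^ 2 - 1) * |x 0| - x 1 ≤ s ∧ |x 0| - (1 - m) * x 1 ≤ m}

theorem mem_extremalBody {s m : ℝ} {x : EuclideanSpace ℝ (Fin 2)} : x ∈ extremalBody s m ↔
    x 1 ≤ 1 ∧ (s ^ 2 - 1) * |x 0| - x 1 ≤ s ∧ |x 0| - (1 - m) * x 1 ≤ m := Iff.rfl

theorem extremalBody_bounds {s m : ℝ} (hs : 1 ≤ s) (hm : m ≤ 1)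
    {x : EuclideanSpace ℝ (Fin 2)} (hx : x ∈ extremalBody s m) :
    |x 0| ≤ 1 ∧ -s ≤ x 1 ∧ x 1 ≤ 1 := by
  obtain ⟨h1, h2, h3⟩ := mem_extremalBody.1 hx
  have h4 : 0 ≤ (s ^ 2 - 1) * |x 0| := mul_nonneg (by nlinarith) (abs_nonneg _)
  have h5 : 0 ≤ (1 - m) * (1 - x 1) := mul_nonneg (by linarith) (by linarith)
  exact ⟨by linarith, by linarith, h1⟩

theorem convex_extremalBody {s m : ℝ} (hs : 1 ≤ s) : Convex ℝ (extremalBody s m) := by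
  intro x hx y hy a b ha hb hab
  obtain ⟨hx1, hx2, hx3⟩ := mem_extremalBody.1 hx
  obtain ⟨hy1, hy2, hy3⟩ := mem_extremalBody.1 hy
  have habs : |a * x 0 + b * y 0| ≤ a * |x 0| + b * |y 0| := by
    refine (abs_add_le _ _).trans_eq ?_
    rw [abs_mul, abs_mul, abs_of_nonneg ha, abs_of_nonneg hb]
  have hs2 : 0 ≤ s ^ 2 - 1 := by nlinarith
  have hb' : b = 1 - a := by linarith
  simp only [mem_extremalBody, PiLp.add_apply, PiLp.smul_apply, smul_eq_mul]
  refine ⟨?_, ?_, ?_⟩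
  · nlinarith [mul_le_mul_of_nonneg_left hx1 ha, mul_le_mul_of_nonneg_left hy1 hb]
  · nlinarith [mul_le_mul_of_nonneg_left hx2 ha, mul_le_mul_of_nonneg_left hy2 hb,
      mul_le_mul_of_nonneg_left habs hs2]
  · have hm : a * m + b * m = m := by rw [← add_mul, hab, one_mul]
    linarith [mul_le_mul_of_nonneg_left hx3 ha, mul_le_mul_of_nonneg_left hy3 hb]

theorem isCompact_extremalBody {s m : ℝ} (hs : 1 ≤ s) (hm : m ≤ 1) :
    IsCompact (extremalBody s m) := by
  refine Metric.isCompact_of_isClosed_isBounded ?_ ?_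
  · have h1 : IsClosed {x : EuclideanSpace ℝ (Fin 2) | x 1 ≤ 1} :=
      isClosed_le (by fun_prop) continuous_const
    have h2 : IsClosed {x : EuclideanSpace ℝ (Fin 2) | (s ^ 2 - 1) * |x 0| - x 1 ≤ s} :=
      isClosed_le (by fun_prop) continuous_const
    have h3 : IsClosed {x : EuclideanSpace ℝ (Fin 2) | |x 0| - (1 - m) * x 1 ≤ m} :=
      isClosed_le (by fun_prop) continuous_const
    exact h1.inter (h2.inter h3)
  · refine (Metric.isBounded_iff_subset_closedBall 0).2 ⟨1 + s, fun x hx => ?_⟩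
    obtain ⟨h0, h1, h1'⟩ := extremalBody_bounds hs hm hx
    rw [mem_closedBall_zero_iff, EuclideanSpace.norm_eq, Fin.sum_univ_two, Real.norm_eq_abs,
      Real.norm_eq_abs]
    refine Real.sqrt_le_iff.2 ⟨by linarith, ?_⟩
    have h2 : |x 1| ≤ s := abs_le.2 ⟨h1, by linarith⟩
    nlinarith [abs_nonneg (x 0), abs_nonneg (x 1)]

theorem extremalBody_mem_nhds_zero {s m : ℝ} (hs : 1 ≤ s) (hm : 0 < m) :
    extremalBody s m ∈ nhds 0 := by
  have h1 : ∀ᶠ x : EuclideanSpace ℝ (Fin 2) in nhds 0, x 1 < 1 :=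
    ContinuousAt.eventually_lt (by fun_prop) (by fun_prop) (by simp)
  have h2 : ∀ᶠ x : EuclideanSpace ℝ (Fin 2) in nhds 0, (s ^ 2 - 1) * |x 0| - x 1 < s :=
    ContinuousAt.eventually_lt (by fun_prop) (by fun_prop) (by simp; linarith)
  have h3 : ∀ᶠ x : EuclideanSpace ℝ (Fin 2) in nhds 0, |x 0| - (1 - m) * x 1 < m :=
    ContinuousAt.eventually_lt (by fun_prop) (by fun_prop) (by simpa)
  filter_upwards [h1, h2, h3] with x h1 h2 h3
  exact ⟨h1.le, h2.le, h3.le⟩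

theorem isConvexBody_extremalBody {s m : ℝ} (hs : 1 ≤ s) (hm0 : 0 < m) (hm : m ≤ 1) :
    IsConvexBody (extremalBody s m) :=
  ⟨convex_extremalBody hs, isCompact_extremalBody hs hm,
    ⟨0, mem_interior_iff_mem_nhds.2 (extremalBody_mem_nhds_zero hs hm0)⟩⟩

/-- The lower bound on `m` enters in the last inequality: `|x 0| + (1 - m) x 1 ≤ m + 2(1 - m) = 2 -
m ≤ s m`. -/
theorem neg_inv_smul_mem_extremalBody {s m : ℝ} (hs : 1 ≤ s) (hm : m ≤ 1)
    (hsm : 2 / (s + 1) ≤ m) {x : EuclideanSpace ℝ (Fin 2)} (hx : x ∈ extremalBody s m) :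
    -(s⁻¹ • x) ∈ extremalBody s m := by
  obtain ⟨h0, h1, h1'⟩ := extremalBody_bounds hs hm hx
  obtain ⟨-, h2, h3⟩ := mem_extremalBody.1 hx
  have hs0 : 0 < s := by linarith
  rw [div_le_iff₀ (by linarith)] at hsm
  have hs2 : 0 ≤ s ^ 2 - 1 := by nlinarith
  simp only [mem_extremalBody, PiLp.neg_apply, PiLp.smul_apply, smul_eq_mul, abs_neg, abs_mul,
    abs_of_pos (inv_pos.2 hs0)]
  refine ⟨?_, ?_, ?_⟩
  · rw [← mul_neg, inv_mul_le_iff₀ hs0]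
    linarith
  · have : (s ^ 2 - 1) * (s⁻¹ * |x 0|) - -(s⁻¹ * x 1) = s⁻¹ * ((s ^ 2 - 1) * |x 0| + x 1) := by ring
    rw [this, inv_mul_le_iff₀ hs0]
    nlinarith
  · have : s⁻¹ * |x 0| - (1 - m) * -(s⁻¹ * x 1) = s⁻¹ * (|x 0| + (1 - m) * x 1) := by ring
    rw [this, inv_mul_le_iff₀ hs0]
    nlinarith

/-- This is where `s ≤ 2` is essential: the second inequality reads `s² - 1 - 1 ≤ s`. -/
theorem corner_mem_extremalBody {s m t : ℝ} (hs : 1 ≤ s) (hs2 : s ≤ 2) (ht : |t| = 1) :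
    !₂[t, 1] ∈ extremalBody s m := by
  simp only [mem_extremalBody]
  simp [ht]
  nlinarith

theorem apex_mem_extremalBody {s m : ℝ} (hs : 1 ≤ s) (hs2 : s ≤ 2)
    (hsm : 2 / (s + 1) ≤ m) :
    !₂[0, -s] ∈ extremalBody s m := by
  rw [div_le_iff₀ (by linarith)] at hsm
  simp only [mem_extremalBody]
  simp
  constructor <;> nlinarith

theorem side_mem_extremalBody {s m : ℝ} (hms : m * (s ^ 2 - 1) ≤ s) {t : ℝ}
    (ht : |t| = m) : !₂[t, 0] ∈ extremalBody s m := by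
  simp only [mem_extremalBody]
  simp [ht]
  linarith

theorem minkowskiAsymmetry_extremalBody {s m : ℝ} (hs : 1 ≤ s) (hs2 : s ≤ 2) (hm : m ≤ 1)
    (hsm : 2 / (s + 1) ≤ m) : minkowskiAsymmetry (extremalBody s m) = s := by
  have hs0 : 0 < s := by linarith
  refine le_antisymm (minkowskiAsymmetry_le hs0 0 fun x hx => ?_) ?_
  · refine ⟨_, neg_inv_smul_mem_extremalBody hs hm hsm hx, ?_⟩
    rw [sub_zero, zero_sub, neg_neg, smul_inv_smul₀ hs0.ne']
  · refine le_csInf ⟨s, hs0, 0, ?_⟩ ?_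
    · rintro _ ⟨x, hx, _, rfl, rfl⟩
      refine ⟨_, ⟨0, rfl, _, neg_inv_smul_mem_extremalBody hs hm hsm hx, rfl⟩, ?_⟩
      simp [smul_inv_smul₀ hs0.ne']
    · rintro ρ ⟨hρ, c, hc⟩
      have key : ∀ x ∈ extremalBody s m, ∃ k ∈ extremalBody s m,
          ∀ i, ρ * k i = (1 + ρ) * c i - x i := by
        intro x hx
        obtain ⟨_, ⟨_, rfl, k, hk, rfl⟩, hxk⟩ := hc ⟨x, hx, c, rfl, rfl⟩
        refine ⟨k, hk, fun i => ?_⟩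
        have := congrArg (fun v => v i) hxk
        simp only [PiLp.smul_apply, PiLp.sub_apply, smul_eq_mul] at this
        linarith
      -- The reflected corners meet the two slanted sides through the apex direction, and the
      -- reflected apex meets the top side. The normals are positively dependent, so adding the
      -- three inequalities with weights 1, 1, 2 eliminates `c`.
      obtain ⟨k₁, ⟨-, h1, -⟩, hk₁⟩ := key _ (corner_mem_extremalBody (t := -1) hs hs2 (by simp))
      obtain ⟨k₂, ⟨-, h2, -⟩, hk₂⟩ := key _ (corner_mem_extremalBody (t := 1) hs hs2 (by simp))
      obtain ⟨k₃, ⟨h3, -, -⟩, hk₃⟩ := key _ (apex_mem_extremalBody hs hs2 hsm)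
      have e10 := hk₁ 0
      have e11 := hk₁ 1
      have e20 := hk₂ 0
      have e21 := hk₂ 1
      have e31 := hk₃ 1
      simp at e10 e11 e20 e21 e31
      have hw : 0 ≤ s ^ 2 - 1 := by nlinarith
      have h1' : (s ^ 2 - 1) * (ρ * k₁ 0) - ρ * k₁ 1 ≤ ρ * s := by
        have := mul_le_mul_of_nonneg_left (le_abs_self (k₁ 0)) hw
        nlinarith
      have h2' : -((s ^ 2 - 1) * (ρ * k₂ 0)) - ρ * k₂ 1 ≤ ρ * s := by
        have := mul_le_mul_of_nonneg_left (neg_abs_le (k₂ 0)) hw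
        nlinarith
      have h3' : ρ * k₃ 1 ≤ ρ := by nlinarith
      rw [e10, e11] at h1'
      rw [e20, e21] at h2'
      rw [e31] at h3'
      have : s * (s + 1) ≤ ρ * (s + 1) := by linarith
      exact le_of_mul_le_mul_right this (by linarith)

theorem isMinkowskiCentered_extremalBody {s m : ℝ} (hs : 1 ≤ s) (hs2 : s ≤ 2) (hm : m ≤ 1)
    (hsm : 2 / (s + 1) ≤ m) : IsMinkowskiCentered (extremalBody s m) := by
  rw [isMinkowskiCentered_iff, minkowskiAsymmetry_extremalBody hs hs2 hm hsm]
  intro x hx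
  refine ⟨_, neg_inv_smul_mem_extremalBody hs hm hsm hx, ?_⟩
  rw [smul_neg, neg_neg, smul_inv_smul₀ (by linarith)]

/-- On the vertical line through `y`, the hexagon with vertices `(±1, ±1)`, `(0, ±s)` reaches
heights `±H` with `H = s - (s - 1)|y 0|`; `y` is a convex combination of these two boundary points.
-/
theorem mem_of_corners_of_apexes {s : ℝ} (hs : 1 ≤ s) {C : Set (EuclideanSpace ℝ (Fin 2))}
    (hC : Convex ℝ C) (hneg : ∀ x ∈ C, -x ∈ C) (hcorner : ∀ t : ℝ, |t| = 1 → !₂[t, 1] ∈ C)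
    (hapex : !₂[0, -s] ∈ C) {y : EuclideanSpace ℝ (Fin 2)} (h0 : |y 0| ≤ 1)
    (h1 : (s - 1) * |y 0| + |y 1| ≤ s) : y ∈ C := by
  obtain ⟨σ, hσ, hσy⟩ : ∃ σ : ℝ, |σ| = 1 ∧ |y 0| * σ = y 0 := by
    rcases abs_choice (y 0) with h | h
    · exact ⟨1, by simp, by rw [h, mul_one]⟩
    · exact ⟨-1, by simp, by rw [h]; ring⟩
  set t := |y 0| with ht
  have ht0 : 0 ≤ t := abs_nonneg _
  set H := s - (s - 1) * t with hH
  have hHpos : 0 < H := by nlinarith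
  have htop := hC (hneg _ hapex) (hcorner σ hσ) (a := 1 - t) (b := t) (by linarith) ht0 (by ring)
  have hbot := hC hapex (hneg _ (hcorner (-σ) (by rwa [abs_neg]))) (a := 1 - t) (b := t)
    (by linarith) ht0 (by ring)
  have hy1 := abs_le.1 (show |y 1| ≤ H by linarith)
  have hu : 0 ≤ (1 + y 1 / H) / 2 := by
    have : -1 ≤ y 1 / H := by rw [le_div_iff₀ hHpos]; linarith
    linarith
  have hv : 0 ≤ (1 - y 1 / H) / 2 := by
    have : y 1 / H ≤ 1 := by rw [div_le_iff₀ hHpos]; linarith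
    linarith
  have hmem := hC htop hbot hu hv (by ring)
  convert hmem using 1
  ext i
  fin_cases i
  · simp
    linear_combination -hσy
  · simp
    have : y 1 / H * H = y 1 := div_mul_cancel₀ _ hHpos.ne'
    rw [hH] at this ⊢
    linear_combination -this

/-- For `≤`, the intersection fits into `m` times the hexagon spanned by the corners, the apex and
their negatives. For `≥`, the point `(m, 0)` lies in the intersection while `|x 0| ≤ 1` on the body.
-/
theorem alpha_extremalBody {s m : ℝ} (hs : 1 ≤ s) (hs2 : s ≤ 2) (hm : m ≤ 1)
    (hsm : 2 / (s + 1) ≤ m) (hms : m * (s ^ 2 - 1) ≤ s) : alpha (extremalBody s m) = m := by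
  have hm0 : 0 < m := lt_of_lt_of_le (by positivity) hsm
  have hnhds := extremalBody_mem_nhds_zero hs hm0
  obtain ⟨⟨x, hx, hxα⟩, hmax⟩ :=
    alpha_spec (convex_extremalBody (m := m) hs) (isCompact_extremalBody hs hm) hnhds
  apply le_antisymm
  · rw [← hxα]
    obtain ⟨h1, h2, h3⟩ := mem_extremalBody.1 hx.1
    obtain ⟨h1', h2', h3'⟩ := mem_extremalBody.1 hx.2
    simp only [PiLp.neg_apply, abs_neg] at h1' h2' h3'
    have hx0 : |x 0| ≤ m := by linarith
    have hx1 : |x 1| ≤ 1 := abs_le.2 ⟨by linarith, h1⟩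
    have hx01 : (s ^ 2 - 1) * |x 0| + |x 1| ≤ s := by
      rcases abs_choice (x 1) with h | h <;> rw [h] <;> linarith
    have hbound : (s - 1) * |x 0| + |x 1| ≤ m * s := by
      rw [div_le_iff₀ (by linarith)] at hsm
      -- The left side is `((s² - 1)|x 0| + |x 1|) + s|x 1| ≤ 2s`, and `2 ≤ m(s + 1)`.
      have : (s + 1) * ((s - 1) * |x 0| + |x 1|) ≤ (s + 1) * (m * s) := by nlinarith
      exact le_of_mul_le_mul_left this (by linarith)
    refine gauge_le_of_mem hm0.le ?_
    rw [Set.mem_smul_set_iff_inv_smul_mem₀ hm0.ne']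
    refine mem_of_corners_of_apexes hs (convex_convexHull ℝ _)
      (fun _ => neg_mem_convexHull_union_neg)
      (fun t ht => subset_convexHull ℝ _ (Or.inl (corner_mem_extremalBody hs hs2 ht)))
      (subset_convexHull ℝ _ (Or.inl (apex_mem_extremalBody hs hs2 hsm))) ?_ ?_
    · rw [PiLp.smul_apply, smul_eq_mul, abs_mul, abs_of_pos (inv_pos.2 hm0), inv_mul_le_iff₀ hm0]
      linarith
    · simp only [PiLp.smul_apply, smul_eq_mul, abs_mul, abs_of_pos (inv_pos.2 hm0)]
      rw [mul_left_comm, ← mul_add, inv_mul_le_iff₀ hm0]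
      exact hbound
  · have hA : !₂[m, 0] ∈ extremalBody s m ∩ -extremalBody s m := by
      refine ⟨side_mem_extremalBody hms (abs_of_pos hm0), ?_⟩
      rw [Set.mem_neg]
      convert side_mem_extremalBody hms (t := -m) (by rw [abs_neg, abs_of_pos hm0]) using 1
      ext i
      fin_cases i <;> simp
    refine le_trans ?_ (hmax _ hA)
    refine le_gauge_of_inner_le (u := !₂[1, 0]) (H := 1)
      (absorbent_nhds_zero (convexHull_union_neg_mem_nhds_zero hnhds)) one_pos (fun y hy => ?_) ?_
    · refine inner_le_of_mem_convexHull ?_ hy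
      rintro y (hy | hy)
      · have := (abs_le.1 (extremalBody_bounds hs hm hy).1).2
        simpa [inner_fin_two] using this
      · have := (abs_le.1 (extremalBody_bounds hs hm hy).1).1
        simp at this
        simpa [inner_fin_two] using this
    · simp [inner_fin_two]

end Example

/-- The bound `α ≤ min {1, s / (s² - 1)}` is written as a conjunction; for `s = 1` the second
entry of the minimum is `+∞` and imposes no condition. -/
theorem theorem1p1 :
    (∀ K : Set (EuclideanSpace ℝ (Fin 2)), IsConvexBody K → IsMinkowskiCentered K →
      2 / (minkowskiAsymmetry K + 1) ≤ alpha K ∧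
      alpha K ≤ 1 ∧
      (minkowskiAsymmetry K ≠ 1 →
        alpha K ≤ minkowskiAsymmetry K / (minkowskiAsymmetry K ^ 2 - 1))) ∧
    (∀ α s : ℝ, 1 ≤ s → s ≤ 2 →
      2 / (s + 1) ≤ α → α ≤ 1 → (s ≠ 1 → α ≤ s / (s ^ 2 - 1)) →
      ∃ K : Set (EuclideanSpace ℝ (Fin 2)), IsConvexBody K ∧ IsMinkowskiCentered K ∧
        minkowskiAsymmetry K = s ∧ alpha K = α) := by
  refine ⟨fun K hb h => ⟨h.two_div_asymmetry_add_one_le_alpha hb, h.alpha_le_one hb,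
    h.alpha_le hb⟩, fun α s hs hs2 hα hα1 hαs => ?_⟩
  have hα0 : 0 < α := lt_of_lt_of_le (by positivity) hα
  have hms : α * (s ^ 2 - 1) ≤ s := by
    rcases eq_or_ne s 1 with rfl | hne
    · norm_num
    · have : 1 < s := lt_of_le_of_ne hs hne.symm
      exact (le_div_iff₀ (by nlinarith)).1 (hαs hne)
  exact ⟨extremalBody s α, isConvexBody_extremalBody hs hα0 hα1,
    isMinkowskiCentered_extremalBody hs hs2 hα1 hα,
    minkowskiAsymmetry_extremalBody hs hs2 hα1 hα, alpha_extremalBody hs hs2 hα1 hα hms⟩
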